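/- Theorem. Let $\mathbb{T}^2(\mathbb{H})=\{(x,y)\in\mathbb{H}^2 : |x|=|y|=1\}$ with its probability Haar measure $\mu$, and let $P(x,y)=\sum_{\ell,m} x^{\ell}y^{m}a_{\ell,m}$ (a finite sum, $a_{\ell,m}\in\mathbb{H}$) be a non-zero slice regular quaternionic polynomial in two variables. Then: (1) there are constants $C,\delta>0$, depending only on $P$, such that for all $\varepsilon>0$ $$\mu\big(\{(x,y)\in\mathbb{T}^2(\mathbb{H}) : |P(x,y)|\le\varepsilon\}\big)\le C\,\varepsilon^{\delta};$$ (2) the Mahler measure $$m_{\mathbb{H}}(P)=\int_{\mathbb{T}^2(\mathbb{H})}\log|P(x,y)|\,d\mu$$ converges absolutely, and exists as an improper Riemann integral: the zero set of $P$ in $\mathbb{T}^2(\mathbb{H})$ is $\mu$-null; its complement $E$ is the union of an increasing sequence of sets $K_n$ with $\mu$-null boundary over each of which $\log|P|$ is bounded and Riemann integrable; and for every such sequence $(K_n)$ one has $\int_{K_n}\log|P|\,d\mu\to m_{\mathbb{H}}(P)$. (A bounded function on $\mathbb{T}^2(\mathbb{H})$ is Riemann integrable if its Riemann sums over tagged finite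 partitions into sets with $\mu$-null boundary converge as the mesh tends to $0$; integrability over $K_n$ is that of the function extended by $0$.) -/

import Mathlib

open scoped Quaternion

namespace QuaternionMahler

/-- The group of unit quaternions, the unit sphere of `ℍ` with quaternion multiplication. -/
abbrev UnitQuaternion : Type := Metric.sphere (0 : ℍ) 1

noncomputable instance : MeasurableSpace UnitQuaternion := borel UnitQuaternion

instance : BorelSpace UnitQuaternion := ⟨rfl⟩

instance : CompactSpace UnitQuaternion :=
  haveI : ProperSpace ℍ := FiniteDimensional.proper ℝ ℍ
  inferInstance

/-- The unit quaternion torus `T²(ℍ) = {(x, y) ∈ ℍ² : |x| = |y| = 1}`. -/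
abbrev Torus : Type := UnitQuaternion × UnitQuaternion

/-- The Haar measure of the compact group `T²(ℍ)` of total mass one. -/
noncomputable def torusMeasure : MeasureTheory.Measure Torus :=
  MeasureTheory.Measure.haarMeasure ⊤

/-- Slice regular polynomials in two variables: the functions on `ℍ²` of the form
`P(x, y) = ∑ x ^ ℓ₁ * y ^ ℓ₂ * a_{ℓ₁, ℓ₂}`, a finite sum with quaternionic coefficients. -/
def IsSliceRegularPolynomial (P : ℍ → ℍ → ℍ) : Prop :=
  ∃ a : ℕ × ℕ →₀ ℍ, ∀ x y : ℍ, P x y = a.sum fun l c => x ^ l.1 * y ^ l.2 * c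

/-- The function `log |P|` on the torus (of interest where `P ≠ 0`). -/
noncomputable def logAbs (P : ℍ → ℍ → ℍ) (p : Torus) : ℝ :=
  Real.log ‖P p.1 p.2‖

/-- The set of the points of the torus where `log |P|` is finite. -/
def regularSet (P : ℍ → ℍ → ℍ) : Set Torus := {p | P p.1 p.2 ≠ 0}

/-- The quaternionic Mahler measure `m_ℍ(P) = ∫ log |P| dμ` over `T²(ℍ)`. -/
noncomputable def mahlerMeasure (P : ℍ → ℍ → ℍ) : ℝ :=
  ∫ p, logAbs P p ∂torusMeasure

section Riemann

variable {X : Type*} [PseudoMetricSpace X] [MeasurableSpace X]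

/-- Jordan measurability of a subset of a compact space with a finite Borel measure:
the boundary is negligible. -/
def JordanMeasurable (μ : MeasureTheory.Measure X) (A : Set X) : Prop :=
  μ (frontier A) = 0

/-- A finite partition of the space into Jordan measurable pieces, with a tag in each piece. -/
structure TaggedPartition (μ : MeasureTheory.Measure X) where
  size : ℕ
  piece : Fin size → Set X
  jordan : ∀ i, JordanMeasurable μ (piece i)
  disjoint : Pairwise fun i j => Disjoint (piece i) (piece j)
  cover : ⋃ i, piece i = Set.univ
  tag : Fin size → X
  tag_mem : ∀ i, tag i ∈ piece i

/-- The pieces have diameter less than `d`. -/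
def TaggedPartition.FinerThan {μ : MeasureTheory.Measure X} (π : TaggedPartition μ)
    (d : ℝ) : Prop :=
  ∀ i, ∀ x ∈ π.piece i, ∀ y ∈ π.piece i, dist x y < d

/-- The Riemann sum `∑ f(tᵢ) μ(Aᵢ)`. -/
noncomputable def TaggedPartition.riemannSum {μ : MeasureTheory.Measure X}
    (π : TaggedPartition μ) (f : X → ℝ) : ℝ :=
  ∑ i, f (π.tag i) * μ.real (π.piece i)

/-- `f` is bounded and (properly) Riemann integrable over the compact space `X` with respect
to `μ`, with integral `L`: the Riemann sums tend to `L` as the mesh tends to zero. -/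
def HasRiemannIntegral (μ : MeasureTheory.Measure X) (f : X → ℝ) (L : ℝ) : Prop :=
  (∃ M : ℝ, ∀ x, |f x| ≤ M) ∧
    ∀ η > 0, ∃ d > 0, ∀ π : TaggedPartition μ, π.FinerThan d → |π.riemannSum f - L| < η

/-- An exhaustion of `E` by an increasing sequence of Jordan measurable sets `K n` over each of
which `f` has a proper Riemann integral, equal to `I n`. -/
structure IsRiemannExhaustion (μ : MeasureTheory.Measure X) (E : Set X) (f : X → ℝ)
    (K : ℕ → Set X) (I : ℕ → ℝ) : Prop where
  mono : Monotone K
  iUnion_eq : ⋃ n, K n = E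
  jordan : ∀ n, JordanMeasurable μ (K n)
  hasRiemannIntegral : ∀ n, HasRiemannIntegral μ ((K n).indicator f) (I n)

/-- The improper Riemann integral over `X` of a function `f` that is singular off `E` exists and
equals `L`: the singular set is negligible, `E` can be exhausted by sets over which `f` is
properly Riemann integrable, and for every such exhaustion the integrals tend to `L`. -/
def HasImproperRiemannIntegral (μ : MeasureTheory.Measure X) (E : Set X) (f : X → ℝ)
    (L : ℝ) : Prop :=
  μ Eᶜ = 0 ∧
    (∃ (K : ℕ → Set X) (I : ℕ → ℝ), IsRiemannExhaustion μ E f K I) ∧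
    ∀ (K : ℕ → Set X) (I : ℕ → ℝ), IsRiemannExhaustion μ E f K I →
      Filter.Tendsto I Filter.atTop (nhds L)

end Riemann

end QuaternionMahler

open QuaternionMahler

/-! Everything rests on the power-type sublevel estimate. In one variable, `p(x) = ∑ x ^ l * c l` is
compared with its symmetrization, a real polynomial of degree `2n` with leading coefficient `‖c n‖ ^
2`. On unit quaternions its norm is at most `(∑ ‖c l‖) * ‖p(x)‖`, and since `x` lies in a copy of
`ℂ` inside `ℍ`, real polynomials can be evaluated at a complex number with the same real part. A
small value of `p` therefore forces `x.re` close to the real part of one of at most `2n` complex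
roots, which is rare because the real part of a random unit quaternion does not concentrate
(`coneMeasure_abs_re_sub_le`, `exists_coneMeasure_sublevel_le`).

In two variables, `P` is a polynomial in `x` whose leading coefficient is a nonzero polynomial in
`y`. The one-variable estimate applies first to this coefficient, to discard the few `y` where it is
small, and then in `x` for the remaining `y`; Fubini combines the two
(`IsSliceRegularPolynomial.exists_sublevel_le`).

The layer-cake formula turns the estimate into integrability of `log |P|`. On each set of an
exhaustion the Riemann integral is the Lebesgue integral, because the integrand is bounded and
almost everywhere continuous; convergence along increasing sets then gives the improper integral. -/

namespace QuaternionMahler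

open MeasureTheory Filter Topology Set

/-! ### Riemann integrals compared with Lebesgue integrals -/

section Riemann

variable {X : Type*} [PseudoMetricSpace X] [MeasurableSpace X]

theorem continuousAt_indicator_of_notMem_frontier {Y : Type*} [TopologicalSpace Y] {f : Y → ℝ}
    {K : Set Y} {x : Y} (hf : ContinuousAt f x) (hx : x ∉ frontier K) :
    ContinuousAt (K.indicator f) x := by
  by_cases hK : K ∈ 𝓝 x
  · refine hf.congr ?_
    filter_upwards [hK] with y hy
    rw [indicator_of_mem hy]
  · have h2 : Kᶜ ∈ 𝓝 x := by
      rw [frontier_eq_closure_inter_closure, mem_inter_iff, not_and_or,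
        ← mem_compl_iff, ← mem_compl_iff, ← interior_compl, ← interior_compl, compl_compl,
        mem_interior_iff_mem_nhds, mem_interior_iff_mem_nhds] at hx
      exact hx.resolve_right hK
    refine (continuousAt_const (y := (0 : ℝ))).congr ?_
    filter_upwards [h2] with y hy
    rw [indicator_of_notMem hy]

/-- The step function attached to a tagged partition. -/
noncomputable def TaggedPartition.step {μ : Measure X} (π : TaggedPartition μ) (f : X → ℝ) :
    X → ℝ :=
  fun x => ∑ i, (π.piece i).indicator (fun _ => f (π.tag i)) x

theorem TaggedPartition.exists_step_eq {μ : Measure X} (π : TaggedPartition μ) (f : X → ℝ)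
    (x : X) : ∃ i, x ∈ π.piece i ∧ π.step f x = f (π.tag i) := by
  have hx : x ∈ ⋃ i, π.piece i := π.cover ▸ mem_univ x
  obtain ⟨i, hi⟩ := mem_iUnion.1 hx
  refine ⟨i, hi, ?_⟩
  rw [TaggedPartition.step, Finset.sum_eq_single i, indicator_of_mem hi]
  · intro j _ hj
    exact indicator_of_notMem (fun h => (π.disjoint hj).le_bot ⟨h, hi⟩) _
  · simp

variable [BorelSpace X]

theorem JordanMeasurable.nullMeasurableSet {μ : Measure X} {A : Set X}
    (h : JordanMeasurable μ A) : NullMeasurableSet A μ :=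
  nullMeasurableSet_of_null_frontier h

theorem TaggedPartition.aestronglyMeasurable_step {μ : Measure X} (π : TaggedPartition μ)
    (f : X → ℝ) : AEStronglyMeasurable (π.step f) μ := by
  have : ∀ i ∈ Finset.univ, AEStronglyMeasurable
      ((π.piece i).indicator (fun _ => f (π.tag i))) μ := fun i _ =>
    aestronglyMeasurable_const.indicator₀ (π.jordan i).nullMeasurableSet
  convert Finset.aestronglyMeasurable_sum Finset.univ this using 1
  ext x
  simp [TaggedPartition.step]

theorem TaggedPartition.integral_step {μ : Measure X} [IsFiniteMeasure μ]
    (π : TaggedPartition μ) (f : X → ℝ) : ∫ x, π.step f x ∂μ = π.riemannSum f := by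
  unfold TaggedPartition.step TaggedPartition.riemannSum
  rw [integral_finsetSum]
  · refine Finset.sum_congr rfl fun i _ => ?_
    rw [integral_indicator₀ (π.jordan i).nullMeasurableSet, setIntegral_const, smul_eq_mul,
      mul_comm]
  · intro i _
    exact (integrable_const _).indicator₀ (π.jordan i).nullMeasurableSet

/-- A bounded, almost everywhere continuous function is Riemann integrable, with its Lebesgue
integral as Riemann integral. -/
theorem hasRiemannIntegral_of_ae_continuousAt {μ : Measure X} [IsFiniteMeasure μ] {f : X → ℝ}
    {M : ℝ} (hM : ∀ x, |f x| ≤ M) (hc : ∀ᵐ x ∂μ, ContinuousAt f x) :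
    HasRiemannIntegral μ f (∫ x, f x ∂μ) := by
  refine ⟨⟨M, hM⟩, ?_⟩
  by_contra! hcon
  obtain ⟨η, hη, h⟩ := hcon
  -- Partitions of mesh tending to zero whose Riemann sums stay `η` away. At a continuity point of
  -- `f` their step functions converge to `f`, since the tag used at `x` shares a piece with `x`;
  -- dominated convergence gives the contradiction.
  choose π hπ hπη using fun n : ℕ => h (1 / ((n : ℝ) + 1)) (by positivity)
  have hlim : Tendsto (fun n => ∫ x, (π n).step f x ∂μ) atTop (𝓝 (∫ x, f x ∂μ)) := by
    refine tendsto_integral_of_dominated_convergence (fun _ => M)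
      (fun n => (π n).aestronglyMeasurable_step f) (integrable_const _) ?_ ?_
    · intro n
      refine Eventually.of_forall fun x => ?_
      obtain ⟨i, -, hi⟩ := (π n).exists_step_eq f x
      rw [hi]
      exact hM _
    · filter_upwards [hc] with x hx
      choose i hi hi' using fun n => (π n).exists_step_eq f x
      simp_rw [hi']
      refine hx.tendsto.comp (tendsto_iff_dist_tendsto_zero.2 ?_)
      refine squeeze_zero (fun _ => dist_nonneg) (fun n => ?_)
        tendsto_one_div_add_atTop_nhds_zero_nat
      exact (hπ n (i n) _ ((π n).tag_mem _) _ (hi n)).le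
  obtain ⟨n, hn⟩ := ((Metric.tendsto_atTop.1 hlim) η hη).imp fun N hN => hN N le_rfl
  rw [TaggedPartition.integral_step, Real.dist_eq] at hn
  exact absurd hn (not_lt.2 (hπη n))

/-- A compact space has Jordan measurable partitions of arbitrarily small mesh. -/
theorem exists_taggedPartition_finerThan [CompactSpace X] (μ : Measure X) [IsFiniteMeasure μ]
    {d : ℝ} (hd : 0 < d) : ∃ π : TaggedPartition μ, π.FinerThan d := by
  classical
  -- The measure is finite, so a radius with negligible boundary can be found in every interval.
  have hnull : ∀ x : X, ∃ s ∈ Ioo 0 (d / 2), μ (frontier (Metric.ball x s)) = 0 := fun x => by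
    obtain ⟨s, hs, h⟩ := exists_null_frontier_thickening μ {x} (half_pos hd)
    exact ⟨s, hs, by rwa [Metric.thickening_singleton] at h⟩
  choose r hr hrμ using hnull
  obtain ⟨t, ht⟩ := isCompact_univ.elim_finite_subcover (fun x => Metric.ball x (r x))
    (fun x => Metric.isOpen_ball) (fun x _ => mem_iUnion.2 ⟨x, Metric.mem_ball_self (hr x).1⟩)
  -- The pieces are the atoms cut out by the balls of the finite cover: points are grouped by which
  -- balls contain them. Indexing by the range of `sig` keeps only nonempty atoms, so that tags
  -- exist. Off the boundaries of the balls `sig` is locally constant.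
  let sig : X → (t → Prop) := fun x i => x ∈ Metric.ball (i : X) (r i)
  have hfin : Finite (range sig) := Subtype.finite
  obtain ⟨n, ⟨e⟩⟩ := Finite.exists_equiv_fin (range sig)
  have hfr : ∀ c, frontier (sig ⁻¹' {c}) ⊆ ⋃ i : t, frontier (Metric.ball (i : X) (r i)) := by
    intro c x hx
    by_contra hxn
    simp only [mem_iUnion, not_exists] at hxn
    have hev : ∀ᶠ y in 𝓝 x, ∀ i : t, sig y i = sig x i := by
      refine eventually_all.2 fun i => ?_
      by_cases hi : x ∈ Metric.ball (i : X) (r i)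
      · filter_upwards [Metric.isOpen_ball.mem_nhds hi] with y hy
        simp only [sig, hi, hy]
      · have hcl : x ∉ closure (Metric.ball (i : X) (r i)) := fun h =>
          hxn i ⟨h, by rwa [Metric.isOpen_ball.interior_eq]⟩
        filter_upwards [isClosed_closure.isOpen_compl.mem_nhds hcl] with y hy
        have : y ∉ Metric.ball (i : X) (r i) := fun h => hy (subset_closure h)
        simp only [sig, hi, this]
    have hev' : ∀ᶠ y in 𝓝 x, sig y = sig x := hev.mono fun y hy => funext hy
    by_cases hc : sig x = c
    · exact hx.2 (mem_interior_iff_mem_nhds.2 (hev'.mono fun y hy => hy.trans hc))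
    · exact (mem_closure_iff_frequently.1 hx.1) (hev'.mono fun y hy h => hc (hy.symm.trans h))
  refine ⟨⟨n, fun i => sig ⁻¹' {(e.symm i : t → Prop)}, ?_, ?_, ?_,
    fun i => (e.symm i).2.choose, fun i => (e.symm i).2.choose_spec⟩, ?_⟩
  · intro i
    exact measure_mono_null (hfr _) (measure_iUnion_null fun i => hrμ i)
  · intro i j hij
    refine Disjoint.preimage _ (disjoint_singleton.2 fun h => hij ?_)
    exact e.symm.injective (Subtype.ext h)
  · refine eq_univ_of_forall fun x => mem_iUnion.2 ⟨e ⟨sig x, x, rfl⟩, ?_⟩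
    simp
  · intro i x hx y hy
    have hxt := ht (mem_univ x)
    simp only [mem_iUnion] at hxt
    obtain ⟨z, hz, hxz⟩ := hxt
    have hxy : sig y = sig x := (mem_singleton_iff.1 hy).trans (mem_singleton_iff.1 hx).symm
    have hyz : y ∈ Metric.ball z (r z) := by
      have h := congrFun hxy ⟨z, hz⟩
      simp only [sig] at h
      exact h.mpr hxz
    rw [Metric.mem_ball] at hxz hyz
    have := dist_triangle_right x y z
    linarith [(hr z).2]

/-- The definition quantifies over fine partitions, so uniqueness needs such partitions to exist.
This identifies the integrals of an arbitrary exhaustion with Lebesgue integrals. -/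
theorem HasRiemannIntegral.unique [CompactSpace X] {μ : Measure X} [IsFiniteMeasure μ]
    {f : X → ℝ} {L L' : ℝ} (h : HasRiemannIntegral μ f L) (h' : HasRiemannIntegral μ f L') :
    L = L' := by
  by_contra hne
  have hpos : 0 < |L - L'| / 2 := half_pos (abs_pos.2 (sub_ne_zero.2 hne))
  obtain ⟨d, hd, H⟩ := h.2 _ hpos
  obtain ⟨d', hd', H'⟩ := h'.2 _ hpos
  obtain ⟨π, hπ⟩ := exists_taggedPartition_finerThan μ (lt_min hd hd')
  have h1 := H π fun i x hx y hy => (hπ i x hx y hy).trans_le (min_le_left _ _)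
  have h2 := H' π fun i x hx y hy => (hπ i x hx y hy).trans_le (min_le_right _ _)
  rw [abs_sub_comm] at h1
  have := abs_sub_le L (π.riemannSum f) L'
  linarith

/-- An integrable function that is continuous on a conull set `E` has its Lebesgue integral as
improper Riemann integral, as soon as some Riemann exhaustion of `E` exists. -/
theorem hasImproperRiemannIntegral_of_integrable [CompactSpace X] {μ : Measure X}
    [IsFiniteMeasure μ] {E : Set X} {f : X → ℝ} (hE : μ Eᶜ = 0)
    (hc : ∀ x ∈ E, ContinuousAt f x) (hf : Integrable f μ)
    (hex : ∃ (K : ℕ → Set X) (I : ℕ → ℝ), IsRiemannExhaustion μ E f K I) :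
    HasImproperRiemannIntegral μ E f (∫ x, f x ∂μ) := by
  refine ⟨hE, hex, fun K I h => ?_⟩
  have hI : ∀ n, I n = ∫ x in K n, f x ∂μ := fun n => by
    obtain ⟨M, hM⟩ := (h.hasRiemannIntegral n).1
    rw [← integral_indicator₀ (h.jordan n).nullMeasurableSet]
    refine (h.hasRiemannIntegral n).unique (hasRiemannIntegral_of_ae_continuousAt hM ?_)
    filter_upwards [measure_eq_zero_iff_ae_notMem.1 hE,
      measure_eq_zero_iff_ae_notMem.1 (h.jordan n)] with x hx hx'
    exact continuousAt_indicator_of_notMem_frontier (hc x (not_not.1 hx)) hx'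
  have hlim := tendsto_setIntegral_of_monotone₀ (μ := μ) (f := f)
    (fun n => (h.jordan n).nullMeasurableSet) h.mono hf.integrableOn
  rw [h.iUnion_eq, setIntegral_eq_integral_of_ae_compl_eq_zero] at hlim
  · exact hlim.congr fun n => (hI n).symm
  · filter_upwards [measure_eq_zero_iff_ae_notMem.1 hE] with x hx hx'
    exact absurd hx' hx

/-- The superlevel sets of a continuous function with negligible level sets exhaust the regular
set of its logarithm. -/
theorem exists_isRiemannExhaustion_log [CompactSpace X] {μ : Measure X} [IsFiniteMeasure μ]
    {g : X → ℝ} (hg : Continuous g) (hg0 : ∀ x, 0 ≤ g x) (h0 : μ {x | g x = 0} = 0) :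
    ∃ (K : ℕ → Set X) (I : ℕ → ℝ),
      IsRiemannExhaustion μ {x | g x ≠ 0} (fun x => Real.log (g x)) K I := by
  -- Only countably many levels carry mass. Avoiding them, `r n` is picked strictly between `1 / (n
  -- + 2)` and `1 / (n + 1)`, which makes `r` decreasing with limit zero and the superlevel sets
  -- Jordan measurable.
  have hcount : Set.Countable {t : ℝ | 0 < μ {x | g x = t}} :=
    Measure.countable_meas_level_set_pos hg.measurable
  choose r hrμ hr using fun n : ℕ => (hcount.dense_compl ℝ).exists_between
    (one_div_lt_one_div_of_lt (by positivity) (by linarith) :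
      1 / ((n : ℝ) + 1 + 1) < 1 / ((n : ℝ) + 1))
  have hr0 : ∀ n, 0 < r n := fun n => lt_trans (by positivity) (hr n).1
  have hanti : Antitone r := antitone_nat_of_succ_le fun n => by
    refine ((hr (n + 1)).2.trans ?_).le
    convert (hr n).1 using 2
    push_cast
    ring
  have hfr : ∀ n, μ (frontier {x | r n ≤ g x}) = 0 := fun n => by
    refine measure_mono_null (frontier_le_subset_eq continuous_const hg) ?_
    have := hrμ n
    simp only [mem_compl_iff, mem_ofPred_eq, not_lt, nonpos_iff_eq_zero] at this
    simpa only [eq_comm] using this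
  refine ⟨fun n => {x | r n ≤ g x}, fun n => ∫ x, {x | r n ≤ g x}.indicator
    (fun x => Real.log (g x)) x ∂μ, ⟨?_, ?_, hfr, ?_⟩⟩
  · intro m n hmn x hx
    exact (hanti hmn).trans hx
  · ext x
    simp only [mem_iUnion, mem_ofPred_eq]
    refine ⟨fun ⟨n, hn⟩ => ((hr0 n).trans_le hn).ne', fun hx => ?_⟩
    obtain ⟨n, hn⟩ := exists_nat_one_div_lt ((hg0 x).lt_of_ne' hx)
    exact ⟨n, ((hr n).2.trans hn).le⟩
  · intro n
    obtain ⟨M, hM⟩ := isCompact_univ.exists_bound_of_continuousOn hg.continuousOn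
    have hbd : ∀ x, |{x | r n ≤ g x}.indicator (fun x => Real.log (g x)) x| ≤
        |Real.log (r n)| + |Real.log M| := by
      intro x
      by_cases hx : r n ≤ g x
      · rw [indicator_of_mem (by exact hx)]
        have h1 := Real.log_le_log (hr0 n) hx
        have h2 := Real.log_le_log ((hr0 n).trans_le hx) ((le_abs_self _).trans (hM x trivial))
        rw [abs_le]
        constructor
        · linarith [neg_abs_le (Real.log (r n)), abs_nonneg (Real.log M)]
        · linarith [le_abs_self (Real.log M), abs_nonneg (Real.log (r n))]
      · rw [indicator_of_notMem (by exact hx), abs_zero]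
        positivity
    refine hasRiemannIntegral_of_ae_continuousAt hbd ?_
    filter_upwards [measure_eq_zero_iff_ae_notMem.1 h0,
      measure_eq_zero_iff_ae_notMem.1 (hfr n)] with x hx hx'
    exact continuousAt_indicator_of_notMem_frontier (hg.continuousAt.log hx) hx'

end Riemann

/-! ### Volume of neighbourhoods of cones in `ℝ⁴` -/

/-- The set lies in two mirror-image intervals, each of length `√(b + s) - √(b - s) ≤ 2 * √s`.
Negative radicands do no harm, as `√` is then zero. -/
theorem volume_abs_sq_sub_le (b s : ℝ) :
    volume {t : ℝ | |t ^ 2 - b| ≤ s} ≤ ENNReal.ofReal (4 * √s) := by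
  rcases lt_or_ge s 0 with hs | hs
  · have : {t : ℝ | |t ^ 2 - b| ≤ s} = ∅ :=
      eq_empty_of_forall_notMem fun t ht => absurd (abs_nonneg (t ^ 2 - b)) (by
        have : |t ^ 2 - b| ≤ s := ht
        linarith)
    simp [this]
  have hsub : {t : ℝ | |t ^ 2 - b| ≤ s} ⊆
      Icc (√(b - s)) (√(b + s)) ∪ Icc (-√(b + s)) (-√(b - s)) := by
    intro t ht
    have ht' : |t ^ 2 - b| ≤ s := ht
    rw [abs_le] at ht'
    have h1 : √(b - s) ≤ |t| := Real.sqrt_le_iff.2 ⟨abs_nonneg t, by rw [sq_abs]; linarith⟩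
    have h2 : |t| ≤ √(b + s) := Real.le_sqrt_of_sq_le (by rw [sq_abs]; linarith)
    rcases abs_cases t with ⟨h, -⟩ | ⟨h, -⟩
    · exact Or.inl ⟨h ▸ h1, h ▸ h2⟩
    · exact Or.inr ⟨by linarith, by linarith⟩
  have hdiff : √(b + s) - √(b - s) ≤ 2 * √s := by
    rw [sub_le_iff_le_add]
    refine Real.sqrt_le_iff.2 ⟨by positivity, ?_⟩
    have h1 := Real.sq_sqrt hs
    have h2 : b - s ≤ √(b - s) ^ 2 := by
      rw [Real.sq_sqrt']
      exact le_max_left _ _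
    nlinarith [mul_nonneg (Real.sqrt_nonneg s) (Real.sqrt_nonneg (b - s))]
  calc volume {t : ℝ | |t ^ 2 - b| ≤ s}
      ≤ volume (Icc (√(b - s)) (√(b + s))) + volume (Icc (-√(b + s)) (-√(b - s))) :=
        (measure_mono hsub).trans (measure_union_le _ _)
    _ = ENNReal.ofReal (√(b + s) - √(b - s)) + ENNReal.ofReal (√(b + s) - √(b - s)) := by
        rw [Real.volume_Icc, Real.volume_Icc]
        congr 2
        ring
    _ ≤ ENNReal.ofReal (2 * √s) + ENNReal.ofReal (2 * √s) := by gcongr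
    _ = ENNReal.ofReal (4 * √s) := by
        rw [← ENNReal.ofReal_add (by positivity) (by positivity)]
        ring_nf

/-- A set in the unit cube all of whose sections along one coordinate axis are small is small. -/
theorem volume_le_of_section_le {n : ℕ} {S : Set (Fin (n + 1) → ℝ)} (hS : MeasurableSet S)
    (hbd : ∀ v ∈ S, ∀ j, |v j| ≤ 1) (i : Fin (n + 1)) {K : ENNReal}
    (hK : ∀ u : Fin n → ℝ, volume {t : ℝ | i.insertNth (α := fun _ => ℝ) t u ∈ S} ≤ K) :
    volume S ≤ 2 ^ n * K := by
  have hmp := (volume_preserving_piFinSuccAbove (fun _ : Fin (n + 1) => ℝ) i).symm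
  rw [← hmp.measure_preimage hS.nullMeasurableSet, Measure.volume_eq_prod,
    Measure.prod_apply_symm (hmp.measurable hS)]
  let box : Set (Fin n → ℝ) := Icc (fun _ => -1) (fun _ => 1)
  calc ∫⁻ u : Fin n → ℝ, volume {t : ℝ | i.insertNth (α := fun _ => ℝ) t u ∈ S}
      ≤ ∫⁻ u : Fin n → ℝ, box.indicator (fun _ => K) u := by
        refine lintegral_mono fun u => ?_
        by_cases hu : u ∈ box
        · rw [indicator_of_mem hu]
          exact hK u
        · rw [indicator_of_notMem hu, nonpos_iff_eq_zero]
          refine measure_mono_null (fun t ht => ?_) measure_empty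
          have h := fun j => abs_le.1 (hbd _ ht (i.succAbove j))
          simp only [Fin.insertNth_apply_succAbove] at h
          exact hu ⟨fun j => (h j).1, fun j => (h j).2⟩
    _ = 2 ^ n * K := by
        rw [lintegral_indicator_const measurableSet_Icc, Real.volume_Icc_pi, mul_comm]
        norm_num

/-- The region between two cones around the first axis, in the unit ball of `ℝ⁴`, is small. -/
theorem volume_ball_inter_cone_le (a r : ℝ) :
    volume {v : EuclideanSpace ℝ (Fin 4) | ‖v‖ ≤ 1 ∧ |v 0 ^ 2 - a ^ 2 * ‖v‖ ^ 2| ≤ 2 * r} ≤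
      ENNReal.ofReal (64 * √r) := by
  rcases lt_or_ge r 0 with hr | hr
  · refine (measure_mono_null (fun v hv => ?_) measure_empty).le.trans zero_le
    have := (abs_nonneg _).trans hv.2
    exact absurd this (by linarith)
  have hmeas : MeasurableSet {v : EuclideanSpace ℝ (Fin 4) |
      ‖v‖ ≤ 1 ∧ |v 0 ^ 2 - a ^ 2 * ‖v‖ ^ 2| ≤ 2 * r} :=
    (measurableSet_le (f := fun v => ‖v‖) (g := fun _ => (1 : ℝ)) (by fun_prop)
      (by fun_prop)).inter
      (measurableSet_le (f := fun v : EuclideanSpace ℝ (Fin 4) => |v 0 ^ 2 - a ^ 2 * ‖v‖ ^ 2|) (g := fun _ => 2 * r)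
        (by fun_prop) (by fun_prop))
  have hmp := PiLp.volume_preserving_toLp (Fin 4)
  rw [← hmp.measure_preimage hmeas.nullMeasurableSet]
  have hsqrt : √(4 * r) = 2 * √r := by
    rw [Real.sqrt_mul (by norm_num), show (4 : ℝ) = 2 ^ 2 by norm_num,
      Real.sqrt_sq (by norm_num)]
  -- Each section has length at most `4 * √(4 * r) = 8 * √r`, and the other three coordinates range
  -- over a cube of volume `2 ^ 3`, whence `64`.
  have key : ∀ i : Fin 4, (∀ u : Fin 3 → ℝ, ∃ b, ∀ t : ℝ,
      i.insertNth (α := fun _ => ℝ) t u ∈ (WithLp.toLp 2) ⁻¹' {v : EuclideanSpace ℝ (Fin 4) |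
        ‖v‖ ≤ 1 ∧ |v 0 ^ 2 - a ^ 2 * ‖v‖ ^ 2| ≤ 2 * r} → |t ^ 2 - b| ≤ 4 * r) →
      volume ((WithLp.toLp 2) ⁻¹' {v : EuclideanSpace ℝ (Fin 4) |
        ‖v‖ ≤ 1 ∧ |v 0 ^ 2 - a ^ 2 * ‖v‖ ^ 2| ≤ 2 * r}) ≤ ENNReal.ofReal (64 * √r) := by
    intro i h
    refine (volume_le_of_section_le (n := 3) (hmp.measurable hmeas) ?_ i
      (K := ENNReal.ofReal (8 * √r)) ?_).trans ?_
    · intro v hv j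
      exact (PiLp.norm_apply_le (WithLp.toLp 2 v) j).trans hv.1
    · intro u
      obtain ⟨b, hb⟩ := h u
      refine (measure_mono hb).trans ((volume_abs_sq_sub_le b (4 * r)).trans_eq ?_)
      rw [hsqrt]
      ring_nf
    · rw [show (2 : ENNReal) ^ 3 = ENNReal.ofReal 8 by norm_num,
        ← ENNReal.ofReal_mul (by norm_num)]
      ring_nf
      exact le_rfl
  -- In `v 0 ^ 2 - a ^ 2 * ‖v‖ ^ 2` the coefficient of `v 0 ^ 2` is `1 - a ^ 2` and that of `v 1 ^
  -- 2` is `-a ^ 2`. One of them is at least `1 / 2` in absolute value; slicing along that axis and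
  -- dividing at most doubles the bound `2 * r`.
  rcases le_total (a ^ 2) (1 / 2) with h | h
  · refine key 0 fun u => ⟨a ^ 2 * (∑ j, u j ^ 2) / (1 - a ^ 2), fun t ht => ?_⟩
    have ht2 := ht.2
    simp only [EuclideanSpace.real_norm_sq_eq, Fin.sum_univ_succAbove _ (0 : Fin 4),
      Fin.insertNth_apply_same, Fin.insertNth_apply_succAbove] at ht2
    have hpos : 0 < 1 - a ^ 2 := by linarith
    have heq : t ^ 2 - a ^ 2 * (∑ j, u j ^ 2) / (1 - a ^ 2) =
        (t ^ 2 - a ^ 2 * (t ^ 2 + ∑ j, u j ^ 2)) / (1 - a ^ 2) := by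
      field_simp
      ring
    rw [heq, abs_div, abs_of_pos hpos, div_le_iff₀ hpos]
    nlinarith
  · refine key 1 fun u => ⟨(u 0 ^ 2 - a ^ 2 * (∑ j, u j ^ 2)) / a ^ 2, fun t ht => ?_⟩
    have ht2 := ht.2
    have h0 : (Fin.insertNth (α := fun _ => ℝ) (1 : Fin 4) t u : Fin 4 → ℝ) 0 = u 0 :=
      Fin.insertNth_apply_succAbove (α := fun _ => ℝ) (1 : Fin 4) t u 0
    simp only [EuclideanSpace.real_norm_sq_eq, Fin.sum_univ_succAbove _ (1 : Fin 4),
      Fin.insertNth_apply_same, Fin.insertNth_apply_succAbove, h0] at ht2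
    have hpos : 0 < a ^ 2 := by linarith
    have ha0 : a ≠ 0 := fun h0 => by simp [h0] at hpos
    have heq : t ^ 2 - (u 0 ^ 2 - a ^ 2 * (∑ j, u j ^ 2)) / a ^ 2 =
        -((u 0 ^ 2 - a ^ 2 * (t ^ 2 + ∑ j, u j ^ 2)) / a ^ 2) := by
      field_simp
      ring
    rw [heq, abs_neg, abs_div, abs_of_pos hpos, div_le_iff₀ hpos]
    nlinarith

/-! ### Haar measure as a radial projection of Lebesgue measure -/

/-- Radial projection of `ℝ⁴` to the unit quaternions. -/
noncomputable def toUnitQuaternion (v : EuclideanSpace ℝ (Fin 4)) : UnitQuaternion :=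
  open Classical in
  if h : v = 0 then 1 else
    ⟨‖v‖⁻¹ • Quaternion.linearIsometryEquivTuple.symm v, by
      rw [mem_sphere_zero_iff_norm, norm_smul, norm_inv, norm_norm,
        LinearIsometryEquiv.norm_map, inv_mul_cancel₀ (norm_ne_zero_iff.2 h)]⟩

theorem coe_toUnitQuaternion {v : EuclideanSpace ℝ (Fin 4)} (h : v ≠ 0) :
    (toUnitQuaternion v : ℍ) = ‖v‖⁻¹ • Quaternion.linearIsometryEquivTuple.symm v := by
  simp [toUnitQuaternion, h]

theorem measurable_toUnitQuaternion : Measurable toUnitQuaternion := by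
  refine measurable_of_continuousOn_compl_singleton 0 ?_
  rw [Topology.IsInducing.subtypeVal.continuousOn_iff]
  have : ContinuousOn (fun v : EuclideanSpace ℝ (Fin 4) =>
      ‖v‖⁻¹ • Quaternion.linearIsometryEquivTuple.symm v) {0}ᶜ :=
    (continuous_norm.continuousOn.inv₀ fun v hv => norm_ne_zero_iff.2 hv).smul
      (LinearIsometryEquiv.continuous _).continuousOn
  exact this.congr fun v hv => coe_toUnitQuaternion hv

/-- Left multiplication by a unit quaternion as a rotation of `ℝ⁴`. -/
noncomputable def leftRotation (g : UnitQuaternion) :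
    EuclideanSpace ℝ (Fin 4) ≃ₗᵢ[ℝ] EuclideanSpace ℝ (Fin 4) :=
  LinearIsometry.toLinearIsometryEquiv
    ⟨Quaternion.linearIsometryEquivTuple.toLinearEquiv.toLinearMap ∘ₗ
      LinearMap.mulLeft ℝ (g : ℍ) ∘ₗ
        Quaternion.linearIsometryEquivTuple.symm.toLinearEquiv.toLinearMap, fun v => by
      change ‖Quaternion.linearIsometryEquivTuple
        ((g : ℍ) * Quaternion.linearIsometryEquivTuple.symm v)‖ = ‖v‖
      rw [LinearIsometryEquiv.norm_map, norm_mul, mem_sphere_zero_iff_norm.1 g.2, one_mul,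
        LinearIsometryEquiv.norm_map]⟩ rfl

theorem leftRotation_apply (g : UnitQuaternion) (v : EuclideanSpace ℝ (Fin 4)) :
    leftRotation g v = Quaternion.linearIsometryEquivTuple
      (g * Quaternion.linearIsometryEquivTuple.symm v) := rfl

theorem toUnitQuaternion_leftRotation (g : UnitQuaternion) {v : EuclideanSpace ℝ (Fin 4)}
    (hv : v ≠ 0) : toUnitQuaternion (leftRotation g v) = g * toUnitQuaternion v := by
  have h : leftRotation g v ≠ 0 := (map_ne_zero_iff _ (leftRotation g).injective).2 hv
  refine Subtype.ext ?_
  rw [coe_toUnitQuaternion h, Metric.unitSphere.coe_mul, coe_toUnitQuaternion hv,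
    LinearIsometryEquiv.norm_map, leftRotation_apply, LinearIsometryEquiv.symm_apply_apply,
    mul_smul_comm]

/-- An invariant measure on the unit quaternions, the radial projection of Lebesgue measure on
the unit ball. -/
noncomputable def coneMeasure : Measure UnitQuaternion :=
  (volume.restrict (Metric.closedBall (0 : EuclideanSpace ℝ (Fin 4)) 1)).map toUnitQuaternion

instance : IsFiniteMeasure (volume.restrict (Metric.closedBall (0 : EuclideanSpace ℝ (Fin 4)) 1)) :=
  ⟨by
    rw [Measure.restrict_apply_univ]
    exact measure_closedBall_lt_top⟩

instance : IsFiniteMeasure coneMeasure := by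
  unfold coneMeasure
  infer_instance

theorem coneMeasure_univ_pos : 0 < coneMeasure univ := by
  rw [coneMeasure, Measure.map_apply measurable_toUnitQuaternion MeasurableSet.univ,
    preimage_univ, Measure.restrict_apply_univ]
  exact Metric.measure_closedBall_pos _ _ one_pos

instance : Measure.IsMulLeftInvariant coneMeasure := by
  refine ⟨fun g => ?_⟩
  have hrot := ((leftRotation g).measurePreserving.restrict_preimage
    (Metric.isClosed_closedBall (x := (0 : EuclideanSpace ℝ (Fin 4))) (ε := 1)).measurableSet)
  have hball : leftRotation g ⁻¹' Metric.closedBall 0 1 = Metric.closedBall 0 1 := by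
    ext v
    simp
  rw [hball] at hrot
  -- The projection has a default value at the origin and need not commute with rotations there, but
  -- the origin is negligible.
  have hne : ∀ᵐ v : EuclideanSpace ℝ (Fin 4) ∂volume.restrict (Metric.closedBall 0 1), v ≠ 0 :=
    ae_restrict_of_ae (Measure.ae_ne volume 0)
  calc Measure.map (fun x => g * x) coneMeasure
      = Measure.map ((fun x => g * x) ∘ toUnitQuaternion)
          (volume.restrict (Metric.closedBall 0 1)) :=
        Measure.map_map (measurable_const_mul g) measurable_toUnitQuaternion
    _ = Measure.map (toUnitQuaternion ∘ leftRotation g)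
          (volume.restrict (Metric.closedBall 0 1)) :=
        Measure.map_congr (hne.mono fun v hv => (toUnitQuaternion_leftRotation g hv).symm)
    _ = coneMeasure := by
        rw [← Measure.map_map measurable_toUnitQuaternion hrot.measurable, hrot.map_eq,
          coneMeasure]

theorem norm_coe_unitQuaternion (x : UnitQuaternion) : ‖(x : ℍ)‖ = 1 :=
  mem_sphere_zero_iff_norm.1 x.2

theorem abs_re_le_norm (x : ℍ) : |x.re| ≤ ‖x‖ := by
  refine abs_le_of_sq_le_sq ?_ (norm_nonneg x)
  rw [sq ‖x‖, ← Quaternion.normSq_eq_norm_mul_self, Quaternion.normSq_def']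
  nlinarith [sq_nonneg x.imI, sq_nonneg x.imJ, sq_nonneg x.imK]

/-- The real part of a unit quaternion does not concentrate near any value. -/
theorem coneMeasure_abs_re_sub_le (a r : ℝ) :
    coneMeasure {x : UnitQuaternion | |(x : ℍ).re - a| ≤ r} ≤ ENNReal.ofReal (64 * √r) := by
  -- Real parts of unit quaternions lie in `[-1, 1]`, so clamping `a` to that interval only enlarges
  -- the set. Then `|t + a| ≤ 2`, which lets the bound on `t - a` pass to squares.
  wlog ha : |a| ≤ 1 generalizing a
  · refine (measure_mono fun x hx => ?_).trans (this (max (-1) (min a 1)) ?_)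
    · have h1 := abs_le.1 ((abs_re_le_norm x).trans_eq (norm_coe_unitQuaternion x))
      have hx : |(x : ℍ).re - a| ≤ r := hx
      change |(x : ℍ).re - _| ≤ r
      rw [abs_le] at hx ⊢
      rcases max_cases (-1) (min a 1) with h | h <;> rcases min_cases a 1 with h' | h' <;>
        constructor <;> linarith
    · rw [abs_le]
      exact ⟨le_max_left _ _, max_le (by norm_num) (min_le_right _ _)⟩
  have hmeas : MeasurableSet {x : UnitQuaternion | |(x : ℍ).re - a| ≤ r} := by
    refine (isClosed_le ?_ continuous_const).measurableSet
    exact ((Quaternion.continuous_re.comp continuous_subtype_val).sub continuous_const).abs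
  rw [coneMeasure, Measure.map_apply measurable_toUnitQuaternion hmeas,
    Measure.restrict_apply (measurable_toUnitQuaternion hmeas)]
  refine le_trans (measure_mono_ae ?_) (volume_ball_inter_cone_le a r)
  filter_upwards [Measure.ae_ne volume (0 : EuclideanSpace ℝ (Fin 4))] with v hv hmem
  have h1 : ‖v‖ ≤ 1 := mem_closedBall_zero_iff.1 hmem.2
  have h2 : |(toUnitQuaternion v : ℍ).re - a| ≤ r := hmem.1
  refine ⟨h1, ?_⟩
  have hpos : 0 < ‖v‖ := norm_pos_iff.2 hv
  have hre : (toUnitQuaternion v : ℍ).re = ‖v‖⁻¹ * v 0 := by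
    rw [coe_toUnitQuaternion hv]
    rfl
  have h3 := abs_re_le_norm (toUnitQuaternion v)
  rw [norm_coe_unitQuaternion] at h3
  set t := (toUnitQuaternion v : ℍ).re
  have hv0 : v 0 = ‖v‖ * t := by
    rw [hre]
    field_simp
  have hsum : |t + a| ≤ 2 := (abs_add_le _ _).trans (by linarith)
  have hsq : ‖v‖ ^ 2 ≤ 1 := pow_le_one₀ hpos.le h1
  have heq : v 0 ^ 2 - a ^ 2 * ‖v‖ ^ 2 = ‖v‖ ^ 2 * ((t - a) * (t + a)) := by
    rw [hv0]
    ring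
  have hr : 0 ≤ r := (abs_nonneg _).trans h2
  rw [heq, abs_mul, abs_mul, abs_of_nonneg (sq_nonneg ‖v‖)]
  calc ‖v‖ ^ 2 * (|t - a| * |t + a|) ≤ 1 * (r * 2) := by gcongr
    _ = 2 * r := by ring

/-- The Haar measure of the torus is a multiple of the product of the cone measures. -/
theorem exists_torusMeasure_eq_smul :
    ∃ c : ENNReal, torusMeasure = c • coneMeasure.prod coneMeasure := by
  have : Measure.IsMulLeftInvariant (coneMeasure.prod coneMeasure) :=
    Measure.prod.instIsMulLeftInvariant
  have h := Measure.haarMeasure_unique (coneMeasure.prod coneMeasure)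
    (⊤ : TopologicalSpace.PositiveCompacts Torus)
  set k := (coneMeasure.prod coneMeasure) ((⊤ : TopologicalSpace.PositiveCompacts Torus) : Set Torus)
    with hk
  have hk' : k = coneMeasure univ * coneMeasure univ := by
    rw [hk, TopologicalSpace.PositiveCompacts.coe_top, ← univ_prod_univ, Measure.prod_prod]
  have hk0 : k ≠ 0 := by
    rw [hk']
    exact mul_ne_zero coneMeasure_univ_pos.ne' coneMeasure_univ_pos.ne'
  have hkt : k ≠ ⊤ := by
    rw [hk']
    exact ENNReal.mul_ne_top (measure_ne_top _ _) (measure_ne_top _ _)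
  refine ⟨k⁻¹, ?_⟩
  rw [h, smul_smul, ENNReal.inv_mul_cancel hk0 hkt, one_smul, torusMeasure]

instance : IsProbabilityMeasure torusMeasure :=
  ⟨Measure.haarMeasure_self (K₀ := (⊤ : TopologicalSpace.PositiveCompacts Torus))⟩

/-! ### Quaternionic polynomials in one variable -/

open Polynomial

theorem exists_imaginary_unit (x : ℍ) :
    ∃ (J : ℍ) (b : ℝ), J.re = 0 ∧ Quaternion.normSq J = 1 ∧ x = algebraMap ℝ ℍ x.re + b • J := by
  by_cases h : x.im = 0
  · have hx := Quaternion.re_add_im x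
    rw [h, add_zero] at hx
    refine ⟨((Complex.I : ℂ) : ℍ), 0, by simp, by simp [Quaternion.normSq_def'], ?_⟩
    rw [zero_smul, add_zero]
    exact hx.symm
  · have hn : ‖x.im‖ ≠ 0 := norm_ne_zero_iff.2 h
    refine ⟨‖x.im‖⁻¹ • x.im, ‖x.im‖, by simp, ?_, ?_⟩
    · rw [Quaternion.normSq_eq_norm_mul_self, norm_smul, norm_inv, norm_norm,
        inv_mul_cancel₀ hn, one_mul]
    · rw [smul_smul, mul_inv_cancel₀ hn, one_smul]
      exact (Quaternion.re_add_im x).symm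

/-- A quaternion behaves like a complex number with the same real part under the evaluation of
real polynomials. -/
theorem exists_complex_norm_aeval_eq (x : ℍ) :
    ∃ z : ℂ, z.re = x.re ∧ ∀ q : ℝ[X], ‖aeval x q‖ = ‖aeval z q‖ := by
  obtain ⟨J, b, hJ0, hJ1, hx⟩ := exists_imaginary_unit x
  have hJ : J * J = -1 := by
    have h := Quaternion.self_mul_star J
    rw [Quaternion.star_eq_neg.2 hJ0, hJ1, mul_neg] at h
    rw [← neg_eq_iff_eq_neg]
    simpa using h
  -- `J` is a unit vector orthogonal to `1`, so sending `Complex.I` to `J` embeds `ℂ` isometrically.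
  have hnorm : ∀ z : ℂ, ‖Complex.liftAux J hJ z‖ = ‖z‖ := fun z => by
    rw [← sq_eq_sq₀ (norm_nonneg _) (norm_nonneg _), sq, ← Quaternion.normSq_eq_norm_mul_self,
      Complex.liftAux_apply, ← Complex.normSq_eq_norm_sq, Complex.normSq_apply,
      Quaternion.normSq_def']
    rw [Quaternion.normSq_def', hJ0] at hJ1
    simp [hJ0]
    linear_combination z.im ^ 2 * hJ1
  refine ⟨⟨x.re, b⟩, rfl, fun q => ?_⟩
  have hφ : Complex.liftAux J hJ ⟨x.re, b⟩ = x := by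
    rw [Complex.liftAux_apply]
    exact hx.symm
  rw [← hnorm, ← aeval_algHom_apply, hφ]

/-- A complex polynomial is small only near its roots. -/
theorem exists_root_norm_sub_le {Q : ℂ[X]} (hQ : Q ≠ 0) {d : ℕ} (hd : Q.natDegree < d) {s : ℝ}
    (hs0 : 0 < s) (hs1 : s < 1) {z : ℂ} (hz : ‖Q.eval z‖ ≤ ‖Q.leadingCoeff‖ * s ^ d) :
    ∃ w ∈ Q.roots, ‖z - w‖ ≤ s := by
  by_contra! hcon
  have hprod : ∀ m : Multiset ℂ, (∀ w ∈ m, s < ‖z - w‖) →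
      s ^ m.card ≤ ‖(m.map fun w => z - w).prod‖ := by
    intro m
    induction m using Multiset.induction with
    | empty => simp
    | cons w m ih =>
      intro h
      rw [Multiset.card_cons, Multiset.map_cons, Multiset.prod_cons, norm_mul, pow_succ']
      exact mul_le_mul (h w (Multiset.mem_cons_self w m)).le
        (ih fun w' hw' => h w' (Multiset.mem_cons_of_mem hw')) (by positivity) (norm_nonneg _)
  have hlead : 0 < ‖Q.leadingCoeff‖ := norm_pos_iff.2 (leadingCoeff_ne_zero.2 hQ)
  have hsplit := IsAlgClosed.splits Q
  rw [hsplit.eval_eq_prod_roots, norm_mul] at hz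
  have h1 := (hprod _ hcon).trans (le_of_mul_le_mul_left hz hlead)
  have h2 : s ^ d < s ^ Q.roots.card :=
    pow_lt_pow_right_of_lt_one₀ hs0 hs1 ((card_roots' Q).trans_lt hd)
  exact absurd h1 (not_le.2 h2)

/-- The symmetrization of the quaternionic polynomial with coefficients `c 0, …, c n`. -/
noncomputable def symmetrization (n : ℕ) (c : ℕ → ℍ) : ℝ[X] :=
  ∑ i ∈ Finset.range (n + 1), ∑ j ∈ Finset.range (n + 1),
    monomial (i + j) (c i * star (c j)).re

/-- Powers of `x` commute with each other, so the right side is the double sum of `x ^ (i + j) * (c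
i * star (c j))`. Exchanging `i` and `j` and adding replaces the coefficient by `c i * star (c j) +
c j * star (c i)`, twice a real part. The factorization through `p(x)` on the right is what bounds
the symmetrization by `‖p(x)‖`. -/
theorem aeval_symmetrization (n : ℕ) (c : ℕ → ℍ) (x : ℍ) :
    aeval x (symmetrization n c) = ∑ j ∈ Finset.range (n + 1),
      x ^ j * (∑ i ∈ Finset.range (n + 1), x ^ i * c i) * star (c j) := by
  have h1 : ∑ j ∈ Finset.range (n + 1),
      x ^ j * (∑ i ∈ Finset.range (n + 1), x ^ i * c i) * star (c j) =
      ∑ j ∈ Finset.range (n + 1), ∑ i ∈ Finset.range (n + 1),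
        x ^ (i + j) * (c i * star (c j)) := by
    refine Finset.sum_congr rfl fun j _ => ?_
    rw [Finset.mul_sum, Finset.sum_mul]
    refine Finset.sum_congr rfl fun i _ => ?_
    rw [add_comm, pow_add]
    noncomm_ring
  have h2 : (2 : ℝ) • aeval x (symmetrization n c) =
      ∑ i ∈ Finset.range (n + 1), ∑ j ∈ Finset.range (n + 1),
        x ^ (i + j) * (c i * star (c j) + c j * star (c i)) := by
    rw [symmetrization, map_sum, Finset.smul_sum]
    refine Finset.sum_congr rfl fun i _ => ?_
    rw [map_sum, Finset.smul_sum]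
    refine Finset.sum_congr rfl fun j _ => ?_
    have h3 := Quaternion.self_add_star' (c i * star (c j))
    rw [star_mul, star_star] at h3
    rw [h3, aeval_monomial, ← Algebra.smul_def, smul_smul]
    exact (Quaternion.mul_coe_eq_smul _ _).symm
  rw [h1]
  refine smul_right_injective ℍ (two_ne_zero' ℝ) ?_
  simp only
  rw [h2, two_smul]
  simp only [mul_add, Finset.sum_add_distrib]
  rw [add_comm]
  congr 1
  · refine Finset.sum_congr rfl fun i _ => Finset.sum_congr rfl fun j _ => ?_
    rw [add_comm]
  · exact Finset.sum_comm

theorem norm_aeval_symmetrization_le (n : ℕ) (c : ℕ → ℍ) {x : ℍ} (hx : ‖x‖ = 1) :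
    ‖aeval x (symmetrization n c)‖ ≤
      (∑ l ∈ Finset.range (n + 1), ‖c l‖) * ‖∑ i ∈ Finset.range (n + 1), x ^ i * c i‖ := by
  rw [aeval_symmetrization, Finset.sum_mul]
  refine (norm_sum_le _ _).trans_eq (Finset.sum_congr rfl fun j _ => ?_)
  rw [norm_mul, norm_mul, norm_pow, hx, one_pow, one_mul, norm_star, mul_comm]

theorem natDegree_symmetrization_le (n : ℕ) (c : ℕ → ℍ) :
    (symmetrization n c).natDegree ≤ 2 * n := by
  refine natDegree_sum_le_of_forall_le _ _ fun i hi =>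
    natDegree_sum_le_of_forall_le _ _ fun j hj => (natDegree_monomial_le _).trans ?_
  rw [Finset.mem_range] at hi hj
  omega

theorem coeff_symmetrization (n : ℕ) (c : ℕ → ℍ) :
    (symmetrization n c).coeff (2 * n) = ‖c n‖ ^ 2 := by
  rw [symmetrization, finsetSum_coeff, Finset.sum_eq_single n, finsetSum_coeff,
    Finset.sum_eq_single n, coeff_monomial, if_pos (by ring), Quaternion.self_mul_star,
    Quaternion.normSq_eq_norm_mul_self, sq]
  · rfl
  · intro j hj hjn
    rw [Finset.mem_range] at hj
    rw [coeff_monomial, if_neg (by omega)]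
  · simp
  · intro i hi hin
    rw [finsetSum_coeff]
    refine Finset.sum_eq_zero fun j hj => ?_
    rw [Finset.mem_range] at hi hj
    rw [coeff_monomial, if_neg (by omega)]
  · simp

/-- The sublevel estimate for quaternionic polynomials in one variable, in terms of the leading
coefficient. -/
theorem exists_coneMeasure_sublevel_le (n : ℕ) :
    ∃ C : ℝ, 0 < C ∧ ∃ δ : ℝ, 0 < δ ∧ ∀ (c : ℕ → ℍ) (A ε : ℝ),
      ∑ l ∈ Finset.range (n + 1), ‖c l‖ ≤ A → c n ≠ 0 → 0 < ε →
      coneMeasure.real {x : UnitQuaternion | ‖∑ l ∈ Finset.range (n + 1), (x : ℍ) ^ l * c l‖ ≤ ε} ≤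
        C * (A * ε / ‖c n‖ ^ 2) ^ δ := by
  have hM : 0 < coneMeasure.real univ :=
    ENNReal.toReal_pos coneMeasure_univ_pos.ne' (measure_ne_top _ _)
  -- There are at most `2 * n` roots, each costing `64 * √s`; the total mass covers the case `ρ ≥
  -- 1`. The exponent combines `s = ρ ^ (1 / (2 * n + 1))` with the square root. Using `2 * n + 1`
  -- instead of the degree `2 * n` gives the strict inequality of the root lemma and includes `n =
  -- 0`.
  refine ⟨128 * n + coneMeasure.real univ, by positivity, ((2 * n + 1 : ℕ) : ℝ)⁻¹ * (1 / 2),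
    by positivity, fun c A ε hA hc hε => ?_⟩
  have hcn : 0 < ‖c n‖ := norm_pos_iff.2 hc
  have hApos : 0 < A := hcn.trans_le <| le_trans
    (Finset.single_le_sum (f := fun l => ‖c l‖) (fun l _ => norm_nonneg _)
      (Finset.self_mem_range_succ n)) hA
  set ρ := A * ε / ‖c n‖ ^ 2 with hρ
  have hρ0 : 0 < ρ := by positivity
  rcases le_or_gt 1 ρ with h1 | h1
  · have h2 : 1 ≤ ρ ^ (((2 * n + 1 : ℕ) : ℝ)⁻¹ * (1 / 2)) :=
      Real.one_le_rpow h1 (by positivity)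
    calc _ ≤ coneMeasure.real univ := measureReal_mono (subset_univ _)
      _ ≤ (128 * n + coneMeasure.real univ) * 1 := by
        rw [mul_one, le_add_iff_nonneg_left]
        positivity
      _ ≤ _ := by gcongr
  · set s := ρ ^ (((2 * n + 1 : ℕ) : ℝ)⁻¹) with hs
    have hs0 : 0 < s := by positivity
    have hs1 : s < 1 := Real.rpow_lt_one hρ0.le h1 (by positivity)
    have hsd : s ^ (2 * n + 1) = ρ := Real.rpow_inv_natCast_pow hρ0.le (by omega)
    set Q := (symmetrization n c).map (algebraMap ℝ ℂ) with hQ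
    have hqdeg : (symmetrization n c).natDegree = 2 * n :=
      natDegree_eq_of_le_of_coeff_ne_zero (natDegree_symmetrization_le n c)
        (by rw [coeff_symmetrization]; positivity)
    have hQdeg : Q.natDegree = 2 * n := by rw [hQ, natDegree_map, hqdeg]
    have hQlead : ‖Q.leadingCoeff‖ = ‖c n‖ ^ 2 := by
      rw [hQ, leadingCoeff_map, leadingCoeff, hqdeg, coeff_symmetrization, Complex.coe_algebraMap,
        Complex.norm_real, Real.norm_of_nonneg (by positivity)]
    have hQ0 : Q ≠ 0 := by
      rw [← leadingCoeff_ne_zero, ← norm_pos_iff, hQlead]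
      positivity
    have hsub : {x : UnitQuaternion | ‖∑ l ∈ Finset.range (n + 1), (x : ℍ) ^ l * c l‖ ≤ ε} ⊆
        ⋃ w ∈ Q.roots.toFinset, {x : UnitQuaternion | |(x : ℍ).re - w.re| ≤ s} := by
      intro x hx
      obtain ⟨z, hz, hzq⟩ := exists_complex_norm_aeval_eq (x : ℍ)
      have hx' : ‖∑ l ∈ Finset.range (n + 1), (x : ℍ) ^ l * c l‖ ≤ ε := hx
      have hle : ‖Q.eval z‖ ≤ ‖Q.leadingCoeff‖ * s ^ (2 * n + 1) := by
        rw [hQ, eval_map_algebraMap, ← hzq, ← hQ, hQlead, hsd, hρ, mul_div_cancel₀ _ (by positivity)]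
        refine (norm_aeval_symmetrization_le n c (norm_coe_unitQuaternion x)).trans ?_
        gcongr
      obtain ⟨w, hw, hzw⟩ := exists_root_norm_sub_le hQ0 (by omega) hs0 hs1 hle
      refine mem_biUnion (by simpa using hw) ?_
      change |(x : ℍ).re - w.re| ≤ s
      rw [← hz, ← Complex.sub_re]
      exact (Complex.abs_re_le_norm _).trans hzw
    have hcard : (Q.roots.toFinset.card : ℝ) ≤ 2 * n := by
      have : Q.roots.toFinset.card ≤ 2 * n :=
        (Multiset.toFinset_card_le _).trans ((card_roots' Q).trans_eq hQdeg)
      exact_mod_cast this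
    have hroot : √s = ρ ^ (((2 * n + 1 : ℕ) : ℝ)⁻¹ * (1 / 2)) := by
      rw [Real.sqrt_eq_rpow, hs, ← Real.rpow_mul hρ0.le]
    rw [← hroot]
    calc _ ≤ coneMeasure.real
          (⋃ w ∈ Q.roots.toFinset, {x : UnitQuaternion | |(x : ℍ).re - w.re| ≤ s}) :=
          measureReal_mono hsub (measure_ne_top _ _)
      _ ≤ ∑ w ∈ Q.roots.toFinset, coneMeasure.real
          {x : UnitQuaternion | |(x : ℍ).re - w.re| ≤ s} := measureReal_biUnion_finset_le _ _
      _ ≤ ∑ w ∈ Q.roots.toFinset, 64 * √s := Finset.sum_le_sum fun w _ =>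
          ENNReal.toReal_le_of_le_ofReal (by positivity) (coneMeasure_abs_re_sub_le w.re s)
      _ = Q.roots.toFinset.card * (64 * √s) := by rw [Finset.sum_const, nsmul_eq_mul]
      _ ≤ 2 * n * (64 * √s) := by gcongr
      _ ≤ (128 * n + coneMeasure.real univ) * √s := by
        nlinarith [mul_pos hM (Real.sqrt_pos.2 hs0)]

/-! ### Integrability of the logarithm -/

/-- The logarithm of a bounded function with power-type sublevel estimates is integrable. -/
theorem integrable_log_of_sublevel_le {X : Type*} [MeasurableSpace X] {μ : Measure X}
    [IsFiniteMeasure μ] {g : X → ℝ} (hg : Measurable g) (hg0 : ∀ x, 0 ≤ g x) {M C δ : ℝ}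
    (hM : ∀ x, g x ≤ M) (hδ : 0 < δ)
    (hsub : ∀ ε : ℝ, 0 < ε → μ.real {x | g x ≤ ε} ≤ C * ε ^ δ) :
    Integrable (fun x => Real.log (g x)) μ := by
  have hmeas : Measurable fun x => max (-Real.log (g x)) 0 :=
    (Real.measurable_log.comp hg).neg.max measurable_const
  have hint : Integrable (fun x => max (-Real.log (g x)) 0) μ := by
    refine ⟨hmeas.aestronglyMeasurable, ?_⟩
    have hnn : 0 ≤ᵐ[μ] fun x => max (-Real.log (g x)) 0 :=
      Eventually.of_forall fun x => le_max_right _ _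
    -- Layer-cake formula: for `t > 0` the negative part of the logarithm reaches `t` only where `g
    -- ≤ exp (-t)`, a set of measure at most `C * exp (-δ * t)`.
    rw [hasFiniteIntegral_iff_ofReal hnn, lintegral_eq_lintegral_meas_le μ hnn hmeas.aemeasurable]
    have hexp : IntegrableOn (fun t : ℝ => C * Real.exp (-δ * t)) (Ioi 0) :=
      (exp_neg_integrableOn_Ioi 0 hδ).const_mul C
    refine lt_of_le_of_lt ?_ hexp.lintegral_lt_top
    refine setLIntegral_mono' measurableSet_Ioi fun t ht => ?_
    rw [← ofReal_measureReal]
    refine ENNReal.ofReal_le_ofReal ?_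
    have h1 := hsub (Real.exp (-t)) (Real.exp_pos _)
    rw [← Real.exp_mul, show -t * δ = -δ * t by ring] at h1
    refine le_trans (measureReal_mono fun x hx => ?_) h1
    have hx' : t ≤ -Real.log (g x) := (le_max_iff.1 hx).resolve_right (not_le.2 ht)
    rcases (hg0 x).eq_or_lt with h0 | h0
    · exact h0.symm.le.trans (Real.exp_pos _).le
    · exact (Real.log_le_iff_le_exp h0).1 (by linarith)
  refine (hint.add (integrable_const (Real.log (max M 1)))).mono'
    (Real.measurable_log.comp hg).aestronglyMeasurable (Eventually.of_forall fun x => ?_)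
  have hlog1 : 0 ≤ Real.log (max M 1) := Real.log_nonneg (le_max_right _ _)
  have hlog2 : Real.log (g x) ≤ Real.log (max M 1) := by
    rcases (hg0 x).eq_or_lt with h0 | h0
    · rwa [← h0, Real.log_zero]
    · exact Real.log_le_log h0 ((hM x).trans (le_max_left _ _))
  change |Real.log (g x)| ≤ max (-Real.log (g x)) 0 + Real.log (max M 1)
  rw [abs_le]
  constructor
  · linarith [le_max_left (-Real.log (g x)) 0]
  · linarith [le_max_right (-Real.log (g x)) 0]

/-! ### Two variables -/

/-- A nonzero slice regular polynomial as a polynomial in `x` whose coefficients are polynomials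
in `y`, with its leading terms. -/
theorem IsSliceRegularPolynomial.exists_coeff {P : ℍ → ℍ → ℍ} (hP : IsSliceRegularPolynomial P)
    (hP0 : P ≠ 0) : ∃ (n m B : ℕ) (a : ℕ → ℕ → ℍ),
      (∀ x y, P x y = ∑ l ∈ Finset.range (n + 1),
        x ^ l * ∑ k ∈ Finset.range (B + 1), y ^ k * a l k) ∧
      a n m ≠ 0 ∧ ∀ y : ℍ, ∑ k ∈ Finset.range (B + 1), y ^ k * a n k =
        ∑ k ∈ Finset.range (m + 1), y ^ k * a n k := by
  obtain ⟨a, ha⟩ := hP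
  have hne : a.support.Nonempty := by
    rw [Finsupp.support_nonempty_iff]
    rintro rfl
    exact hP0 (funext fun x => funext fun y => by simp [ha])
  -- `q` is the lexicographically greatest exponent in the support, `p` having the top degree in
  -- `x`; `r` bounds all degrees in `y`.
  obtain ⟨p, hp, hpmax⟩ := a.support.exists_max_image Prod.fst hne
  obtain ⟨q, hq, hqmax⟩ := (a.support.filter fun l => l.1 = p.1).exists_max_image Prod.snd
    ⟨p, Finset.mem_filter.2 ⟨hp, rfl⟩⟩
  obtain ⟨r, -, hrmax⟩ := a.support.exists_max_image Prod.snd hne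
  rw [Finset.mem_filter] at hq
  refine ⟨p.1, q.2, r.2, fun l k => a (l, k), fun x y => ?_, ?_, fun y => ?_⟩
  · rw [ha, Finsupp.sum_of_support_subset a
      (s := Finset.range (p.1 + 1) ×ˢ Finset.range (r.2 + 1)), Finset.sum_product]
    · refine Finset.sum_congr rfl fun l _ => ?_
      rw [Finset.mul_sum]
      exact Finset.sum_congr rfl fun k _ => mul_assoc _ _ _
    · intro l hl
      rw [Finset.mem_product, Finset.mem_range, Finset.mem_range]
      exact ⟨Nat.lt_succ_of_le (hpmax l hl), Nat.lt_succ_of_le (hrmax l hl)⟩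
    · simp
  · rw [← hq.2]
    exact Finsupp.mem_support_iff.1 hq.1
  · refine (Finset.sum_subset ?_ fun k _ hk => ?_).symm
    · exact Finset.range_subset_range.2 (Nat.succ_le_succ (hrmax q hq.1))
    · rw [Finset.mem_range, not_lt] at hk
      have : a (p.1, k) = 0 := by
        by_contra h
        have := hqmax (p.1, k) (Finset.mem_filter.2 ⟨Finsupp.mem_support_iff.2 h, rfl⟩)
        simp only at this
        omega
      simp only [this, mul_zero]

theorem IsSliceRegularPolynomial.continuous_norm_torus {P : ℍ → ℍ → ℍ}
    (hP : IsSliceRegularPolynomial P) : Continuous fun p : Torus => ‖P p.1 p.2‖ := by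
  obtain ⟨a, ha⟩ := hP
  simp only [ha, Finsupp.sum]
  refine continuous_norm.comp (continuous_finsetSum _ fun l _ => ?_)
  exact (((continuous_subtype_val.comp continuous_fst).pow _).mul
    ((continuous_subtype_val.comp continuous_snd).pow _)).mul continuous_const

theorem continuous_norm_sum_pow_mul (s : Finset ℕ) (c : ℕ → ℍ) :
    Continuous fun y : UnitQuaternion => ‖∑ k ∈ s, (y : ℍ) ^ k * c k‖ :=
  continuous_norm.comp (continuous_finsetSum _ fun k _ =>
    (continuous_subtype_val.pow k).mul continuous_const)

theorem norm_sum_pow_mul_le (s : Finset ℕ) (c : ℕ → ℍ) {y : ℍ} (hy : ‖y‖ = 1) :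
    ‖∑ k ∈ s, y ^ k * c k‖ ≤ ∑ k ∈ s, ‖c k‖ := by
  refine (norm_sum_le _ _).trans_eq (Finset.sum_congr rfl fun k _ => ?_)
  rw [norm_mul, norm_pow, hy, one_pow, one_mul]

/-- If all sections of a set outside a small set of sections are small, then the set is small. -/
theorem measureReal_prod_le_of_section_le {X Y : Type*} [MeasurableSpace X] [MeasurableSpace Y]
    {μ : Measure X} {ν : Measure Y} [IsFiniteMeasure μ] [IsFiniteMeasure ν] {S : Set (X × Y)}
    (hS : MeasurableSet S) {T : Set Y} (hT : MeasurableSet T) {K : ℝ} (hK0 : 0 ≤ K)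
    (hK : ∀ y ∉ T, μ.real {x | (x, y) ∈ S} ≤ K) :
    (μ.prod ν).real S ≤ μ.real univ * ν.real T + K * ν.real univ := by
  have h : (μ.prod ν) S ≤ μ univ * ν T + ENNReal.ofReal K * ν univ := by
    rw [Measure.prod_apply_symm hS]
    calc ∫⁻ y, μ {x | (x, y) ∈ S} ∂ν
        ≤ ∫⁻ y, T.indicator (fun _ => μ univ) y + ENNReal.ofReal K ∂ν := by
          refine lintegral_mono fun y => ?_
          by_cases hy : y ∈ T
          · rw [indicator_of_mem hy]
            exact (measure_mono (subset_univ _)).trans le_self_add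
          · rw [indicator_of_notMem hy, zero_add, ← ofReal_measureReal]
            exact ENNReal.ofReal_le_ofReal (hK y hy)
      _ = μ univ * ν T + ENNReal.ofReal K * ν univ := by
          rw [lintegral_add_right _ measurable_const, lintegral_indicator_const hT,
            lintegral_const]
  rw [← ofReal_measureReal (μ := μ), ← ofReal_measureReal (μ := ν),
    ← ofReal_measureReal (μ := ν), ← ENNReal.ofReal_mul measureReal_nonneg,
    ← ENNReal.ofReal_mul hK0, ← ENNReal.ofReal_add (by positivity) (by positivity)] at h
  exact ENNReal.toReal_le_of_le_ofReal (by positivity) h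

/-- The sublevel estimate for slice regular polynomials in two variables. -/
theorem IsSliceRegularPolynomial.exists_sublevel_le {P : ℍ → ℍ → ℍ}
    (hP : IsSliceRegularPolynomial P) (hP0 : P ≠ 0) :
    ∃ C : ℝ, 0 < C ∧ ∃ δ : ℝ, 0 < δ ∧ ∀ ε : ℝ, 0 < ε →
      torusMeasure.real {p : Torus | ‖P p.1 p.2‖ ≤ ε} ≤ C * ε ^ δ := by
  obtain ⟨n, m, B, a, hPa, hnm, hlead⟩ := hP.exists_coeff hP0
  obtain ⟨C₁, hC₁, δ₁, hδ₁, H₁⟩ := exists_coneMeasure_sublevel_le m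
  obtain ⟨C₂, hC₂, δ₂, hδ₂, H₂⟩ := exists_coneMeasure_sublevel_le n
  obtain ⟨κ, htorus⟩ := exists_torusMeasure_eq_smul
  set c : ℕ → ℍ → ℍ := fun l y => ∑ k ∈ Finset.range (B + 1), y ^ k * a l k with hc
  set A₁ := ∑ k ∈ Finset.range (m + 1), ‖a n k‖ with hA₁
  set A₂ := ∑ l ∈ Finset.range (n + 1), ∑ k ∈ Finset.range (B + 1), ‖a l k‖ with hA₂
  have hA₁0 : 0 ≤ A₁ := Finset.sum_nonneg fun _ _ => norm_nonneg _
  have hA₂0 : 0 ≤ A₂ := Finset.sum_nonneg fun _ _ => Finset.sum_nonneg fun _ _ => norm_nonneg _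
  have hnm0 : 0 < ‖a n m‖ := norm_pos_iff.2 hnm
  -- With threshold `t = ε ^ (1 / 4)` for the leading coefficient, the discarded `y` contribute a
  -- multiple of `t ^ δ₁`. For the others `ε / ‖c n y‖ ^ 2 ≤ ε / t ^ 2 = t ^ 2`, which contributes a
  -- multiple of `t ^ (2 * δ₂)`.
  set δ := min δ₁ (2 * δ₂) with hδ
  have hδ0 : 0 < δ := lt_min hδ₁ (by positivity)
  set K₁ := C₁ * (A₁ / ‖a n m‖ ^ 2) ^ δ₁ with hK₁
  set K₂ := C₂ * A₂ ^ δ₂ with hK₂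
  have hK₁0 : 0 ≤ K₁ := by positivity
  have hK₂0 : 0 ≤ K₂ := by positivity
  set M := coneMeasure.real univ with hM
  have hM0 : 0 ≤ M := measureReal_nonneg
  set L := κ.toReal * (M * K₁ + K₂ * M) with hL
  have hL0 : 0 ≤ L := mul_nonneg ENNReal.toReal_nonneg
    (add_nonneg (mul_nonneg hM0 hK₁0) (mul_nonneg hK₂0 hM0))
  clear_value L M K₁ K₂ δ A₁ A₂
  -- Adding `1` makes the constant positive and settles `ε > 1`, where the total mass `1` is a
  -- sufficient bound.
  refine ⟨L + 1, by positivity, 1 / 4 * δ, by positivity, fun ε hε => ?_⟩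
  rcases le_or_gt ε 1 with hε1 | hε1
  · set t := ε ^ (1 / 4 : ℝ) with ht
    have ht0 : 0 < t := by positivity
    have ht1 : t ≤ 1 := Real.rpow_le_one hε.le hε1 (by norm_num)
    have hεt : ε = t ^ 4 := by
      rw [ht, ← Real.rpow_natCast, ← Real.rpow_mul hε.le]
      norm_num
    have hcont : Continuous fun y : UnitQuaternion => ‖c n y‖ := continuous_norm_sum_pow_mul _ _
    have hT : coneMeasure.real {y : UnitQuaternion | ‖c n y‖ ≤ t} ≤ K₁ * t ^ δ := by
      have h := H₁ (a n) A₁ t hA₁.ge hnm ht0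
      simp only [← hlead] at h
      refine h.trans ?_
      rw [hK₁, mul_div_right_comm, Real.mul_rpow (by positivity) ht0.le, ← mul_assoc]
      gcongr ?_ * ?_
      exact Real.rpow_le_rpow_of_exponent_ge ht0 ht1 (hδ ▸ min_le_left _ _)
    have hS : ∀ y ∉ {y : UnitQuaternion | ‖c n y‖ ≤ t},
        coneMeasure.real {x | (x, y) ∈ {p : Torus | ‖P p.1 p.2‖ ≤ ε}} ≤ K₂ * t ^ δ := by
      intro y hy
      have hyt : t < ‖c n y‖ := not_le.1 hy
      have hsum : ∑ l ∈ Finset.range (n + 1), ‖c l y‖ ≤ A₂ :=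
        hA₂ ▸ Finset.sum_le_sum fun l _ => norm_sum_pow_mul_le _ _ (norm_coe_unitQuaternion y)
      have h := H₂ (fun l => c l y) A₂ ε hsum (norm_pos_iff.1 (ht0.trans hyt)) hε
      simp only [mem_ofPred_eq, hPa]
      refine h.trans ?_
      rw [hK₂, mul_assoc]
      gcongr C₂ * ?_
      calc (A₂ * ε / ‖c n y‖ ^ 2) ^ δ₂ ≤ (A₂ * ε / t ^ 2) ^ δ₂ := by gcongr
        _ = A₂ ^ δ₂ * t ^ (2 * δ₂) := by
          rw [hεt, Real.rpow_mul ht0.le, ← Real.mul_rpow hA₂0 (by positivity)]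
          congr 1
          norm_cast
          field_simp
        _ ≤ A₂ ^ δ₂ * t ^ δ := by
          gcongr ?_ * ?_
          exact Real.rpow_le_rpow_of_exponent_ge ht0 ht1 (hδ ▸ min_le_right _ _)
    have hprod := measureReal_prod_le_of_section_le (μ := coneMeasure) (ν := coneMeasure)
      (isClosed_le hP.continuous_norm_torus continuous_const).measurableSet
      (isClosed_le hcont continuous_const).measurableSet (by positivity) hS
    rw [← hM] at hprod
    rw [htorus, measureReal_ennreal_smul_apply, Real.rpow_mul hε.le, ← ht]
    calc _ ≤ κ.toReal * (M * (K₁ * t ^ δ) + K₂ * t ^ δ * M) := by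
          refine mul_le_mul_of_nonneg_left (hprod.trans ?_) ENNReal.toReal_nonneg
          gcongr
      _ = L * t ^ δ := by rw [hL]; ring
      _ ≤ (L + 1) * t ^ δ := by gcongr; linarith
  · calc _ ≤ (1 : ℝ) := measureReal_le_one
      _ ≤ (L + 1) * 1 := by linarith
      _ ≤ _ := by
        gcongr
        exact Real.one_le_rpow hε1.le (by positivity)

end QuaternionMahler

theorem mainTheorem9 (P : ℍ → ℍ → ℍ) (hP : IsSliceRegularPolynomial P) (hP0 : P ≠ 0) :
    (∃ C : ℝ, 0 < C ∧ ∃ δ : ℝ, 0 < δ ∧ ∀ ε : ℝ, 0 < ε →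
      torusMeasure.real {p : Torus | ‖P p.1 p.2‖ ≤ ε} ≤ C * ε ^ δ) ∧
    MeasureTheory.Integrable (logAbs P) torusMeasure ∧
    HasImproperRiemannIntegral torusMeasure (regularSet P) (logAbs P) (mahlerMeasure P) := by
  have hsub := hP.exists_sublevel_le hP0
  have hcont := hP.continuous_norm_torus
  refine ⟨hsub, ?_⟩
  obtain ⟨C, hC, δ, hδ, h⟩ := hsub
  obtain ⟨M, hM⟩ := isCompact_univ.exists_bound_of_continuousOn hcont.continuousOn
  have hint : MeasureTheory.Integrable (logAbs P) torusMeasure :=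
    integrable_log_of_sublevel_le hcont.measurable (fun _ => norm_nonneg _)
      (fun p => (le_abs_self _).trans (hM p trivial)) hδ h
  have hreg : regularSet P = {p : Torus | ‖P p.1 p.2‖ ≠ 0} := by
    ext p
    exact norm_ne_zero_iff.symm
  -- The zero set lies in every sublevel set, and the bounds tend to zero with `ε`.
  have hnull : torusMeasure {p : Torus | ‖P p.1 p.2‖ = 0} = 0 := by
    have hlim : Filter.Tendsto (fun ε : ℝ => C * ε ^ δ) (nhdsWithin 0 (Set.Ioi 0)) (nhds 0) := by
      have h0 := ((Real.continuousAt_rpow_const 0 δ (Or.inr hδ.le)).tendsto.const_mul C).mono_left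
        (nhdsWithin_le_nhds (s := Set.Ioi 0))
      rwa [Real.zero_rpow hδ.ne', mul_zero] at h0
    have hle : torusMeasure.real {p : Torus | ‖P p.1 p.2‖ = 0} ≤ 0 := by
      refine ge_of_tendsto hlim ?_
      filter_upwards [self_mem_nhdsWithin] with ε hε
      refine le_trans (MeasureTheory.measureReal_mono fun p hp => ?_) (h ε hε)
      have hp' : ‖P p.1 p.2‖ = 0 := hp
      exact hp'.trans_le (Set.mem_Ioi.1 hε).le
    exact (MeasureTheory.measureReal_eq_zero_iff).1
      (le_antisymm hle MeasureTheory.measureReal_nonneg)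
  refine ⟨hint, hasImproperRiemannIntegral_of_integrable ?_ ?_ hint ?_⟩
  · rw [hreg]
    convert hnull using 2
    ext p
    simp
  · intro p hp
    rw [hreg] at hp
    exact hcont.continuousAt.log hp
  · rw [hreg]
    exact exists_isRiemannExhaustion_log hcont (fun _ => norm_nonneg _) hnull
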